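/- Let $K$ be a field, $S=K[x_1,\ldots,x_n]$, and let $\alpha=(k_1,\ldots,k_n)$ be a vector of positive integers. Let $S^\alpha=K[x_{ij} : 1\le i\le n,\ 1\le j\le k_i]$ and $P_i=(x_{i1},\ldots,x_{ik_i})\subset S^\alpha$. For a monomial ideal $I$ let $G(I)$ denote its set of minimal monomial generators. The expansion of a monomial ideal $I\subset S$ is $I^\alpha=\sum_{\mathbf x^{\mathbf a}\in G(I)}P_1^{\mathbf a(1)}\cdots P_n^{\mathbf a(n)}\subset S^\alpha$, and the expansion of a set $\mathcal A$ of monomials of $S$ is $\mathcal A^\alpha=\bigcup_{\mathbf x^{\mathbf u}\in\mathcal A}G\big((\mathbf x^{\mathbf u})^\alpha\big)$. For a set $\mathcal B$ of monomials in a polynomial ring over $K$, the toric ring $K[\mathcal B]$ is the $K$-subalgebra generated by $\mathcal B$. Let $\mathcal A=\{u_1,\ldots,u_m\}$ be a finite set of monomials of $S$. Then $K[\mathcal A]$ is normal (that is, integrally closed in its field of fractions) if and only if $K[\mathcal A^\alpha]$ is normal. -/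

import Mathlib

noncomputable section

namespace Expansion

/-- The toric ring `K[A]`: the `K`-subalgebra of the polynomial ring generated by the monomials
`x ^ u`, `u ∈ A`. A set of monomials is given by the set `A` of its exponent vectors. -/
def toricRing {σ : Type*} (K : Type*) [Field K] (A : Set (σ →₀ ℕ)) :
    Subalgebra K (MvPolynomial σ K) :=
  Algebra.adjoin K ((fun u => MvPolynomial.monomial u (1 : K)) '' A)

/-- `G(I)` for a monomial ideal `I`: the exponent vectors of the monomials that lie in `I` and are
minimal with respect to divisibility (the componentwise order on exponent vectors). -/
def minimalGenerators {σ : Type*} {K : Type*} [Field K] (I : Ideal (MvPolynomial σ K)) :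
    Set (σ →₀ ℕ) :=
  {w | Minimal (fun v => MvPolynomial.monomial v (1 : K) ∈ I) w}

/-- Index set of the variables `x_{ij}`, `1 ≤ i ≤ n`, `1 ≤ j ≤ α i`. -/
abbrev ExpandedVars {n : ℕ} (α : Fin n → ℕ) : Type := Σ i : Fin n, Fin (α i)

/-- The prime monomial ideal `P_j = (x_{j1}, …, x_{jk_j})`, where `k_j = α j`. -/
def blockIdeal {n : ℕ} (K : Type*) [Field K] (α : Fin n → ℕ) (j : Fin n) :
    Ideal (MvPolynomial (ExpandedVars α) K) :=
  Ideal.span (Set.range fun k : Fin (α j) => MvPolynomial.X ⟨j, k⟩)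

/-- The expansion `I^α = ∑_{x^a ∈ G(I)} P_1^{a(1)} ⋯ P_n^{a(n)}` of a monomial ideal `I`. -/
def expandIdeal {n : ℕ} {K : Type*} [Field K] (α : Fin n → ℕ)
    (I : Ideal (MvPolynomial (Fin n) K)) : Ideal (MvPolynomial (ExpandedVars α) K) :=
  ⨆ a ∈ minimalGenerators I, ∏ j, blockIdeal K α j ^ a j

/-- The expansion `A^α = ⋃_{x^u ∈ A} G((x^u)^α)` of a set of monomials. -/
def expandSet {n : ℕ} (K : Type*) [Field K] (α : Fin n → ℕ) (A : Set (Fin n →₀ ℕ)) :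
    Set (ExpandedVars α →₀ ℕ) :=
  ⋃ u ∈ A, minimalGenerators (expandIdeal α (Ideal.span {MvPolynomial.monomial u (1 : K)}))

end Expansion

end

/-!
Let `ℕA` be the monoid generated by `A`; then `K[A]` consists of the polynomials supported on `ℕA`,
and it is normal if and only if `ℕA` is. In one direction, if `a`, `a + w` and `k • w` lie in `ℕA`,
then `(x ^ a) ^ k` divides `(x ^ (a + w)) ^ k` in `K[A]`, so normality of the ring makes `x ^ a`
divide `x ^ (a + w)`. Conversely, an element of the fraction field integral over `K[A]` is a
polynomial `f`; after subtracting from `f` its terms with exponent in `ℕA`, normality of the monoid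
puts the leading exponent of what is left in `ℕA`, so nothing is left. The positive multiple in `ℕA`
of that exponent comes from a nonzero `r` with all `r * f ^ k` in `K[A]`, by Dickson's lemma applied
to the leading exponents of these products.

The set `A^α` is the preimage of `A` under the map `π` that sums the exponents in each block. A
decomposition of `π w` as a sum lifts to one of `w`, so `ℕ(A^α)` is the preimage of `ℕA`, and
normality is unaffected by taking preimages under a surjection.
-/

namespace Expansion

open Finsupp (mapDomain)
open MvPolynomial

universe u

section NormalMonoid

variable {G H : Type*} [AddCommMonoid G] [AddCommMonoid H]

/-- Normality of an additive submonoid `M`: it contains every vector of the group it generates that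
has a positive multiple in `M`. Such a vector is taken in the ambient monoid `G` and presented as
the difference of the two elements `a + w` and `a` of `M`. For `G = ℕ^σ` no vector of `ℤ^σ` is
lost, because a vector with a positive multiple in `ℕ^σ` has nonnegative entries. -/
def IsNormalMonoid (M : AddSubmonoid G) : Prop :=
  ∀ ⦃a w : G⦄ ⦃k : ℕ⦄, a ∈ M → a + w ∈ M → k ≠ 0 → k • w ∈ M → w ∈ M

theorem isNormalMonoid_comap_iff {φ : G →+ H} (hφ : Function.Surjective φ) {M : AddSubmonoid H} :
    IsNormalMonoid (M.comap φ) ↔ IsNormalMonoid M := by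
  simp only [IsNormalMonoid, AddSubmonoid.mem_comap, map_add, map_nsmul, hφ.forall]

theorem exists_nsmul_mem_of_forall_add_nsmul_mem [IsLeftCancelAdd G] {M : AddSubmonoid G}
    (hM : M.FG) {a w : G} (h : ∀ k : ℕ, a + k • w ∈ M) : ∃ k ≠ 0, k • w ∈ M := by
  obtain ⟨B, rfl, hB⟩ := (AddSubmonoid.fg_iff M).1 hM
  have := hB.fintype
  simp only [AddSubmonoid.mem_closure_iff_of_fintype] at h ⊢
  choose c hc using h
  -- Dickson's lemma: the coefficient vector of some `a + j • w` dominates that of an earlier one.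
  obtain ⟨i, j, hij, hle⟩ := wellQuasiOrdered_le (α := B → ℕ) c
  refine ⟨j - i, Nat.sub_ne_zero_of_lt hij, c j - c i, add_left_cancel (a := a + i • w) ?_⟩
  calc a + i • w + (j - i) • w = ∑ s, c j s • (s : G) := by
        rw [add_assoc, ← add_nsmul, Nat.add_sub_cancel' hij.le, hc]
    _ = a + i • w + ∑ s, (c j - c i) s • (s : G) := by
        rw [hc i, ← Finset.sum_add_distrib]
        refine Finset.sum_congr rfl fun s _ => ?_
        rw [← add_nsmul, ← Pi.add_apply, add_tsub_cancel_of_le hle]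

end NormalMonoid

section IntegralClosure

variable {R T : Type*} [CommRing R] [CommRing T] [IsDomain T] [Algebra R T]

theorem isIntegrallyClosed_of_forall_isIntegral [IsIntegrallyClosed T] (S : Subalgebra R T)
    (hS : ∀ f : T, IsIntegral S f → ∀ h ∈ S, h ≠ 0 → h * f ∈ S → f ∈ S) :
    IsIntegrallyClosed S := by
  let F := FractionRing S
  let L := FractionRing T
  have hTL : Function.Injective (algebraMap T L) := IsFractionRing.injective T L
  have hSL : Function.Injective (Algebra.ofId S L) := hTL.comp Subtype.val_injective
  let φ : F →ₐ[S] L := IsFractionRing.liftAlgHom hSL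
  have hφ (s : S) : φ (algebraMap S F s) = algebraMap T L s := φ.commutes s
  refine (isIntegrallyClosed_iff F).2 fun {x} hx => ?_
  have hφx : IsIntegral S (φ x) := hx.map φ
  obtain ⟨f, hf⟩ := IsIntegrallyClosed.isIntegral_iff.1 (hφx.tower_top (A := T))
  obtain ⟨⟨a, b⟩, hab⟩ := IsLocalization.surj (nonZeroDivisors S) x
  have hbf : (b : T) * f = a := hTL <| by
    rw [map_mul, hf, ← hφ, ← hφ, ← map_mul, mul_comm, hab]
  have hfS : f ∈ S := by
    refine hS f ?_ b (b : S).2 ?_ (hbf ▸ a.2)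
    · rwa [← hf, isIntegral_algebraMap_iff hTL] at hφx
    · exact_mod_cast nonZeroDivisors.ne_zero b.2
  exact ⟨⟨f, hfS⟩, φ.toRingHom.injective ((hφ _).trans hf)⟩

end IntegralClosure

section ToricRing

variable {σ K : Type*} [Field K] {A : Set (σ →₀ ℕ)} {f h : MvPolynomial σ K}

variable (K A) in
theorem toSubmodule_toricRing :
    Subalgebra.toSubmodule (toricRing K A) = restrictSupport K (AddSubmonoid.closure A) := by
  rw [toricRing, Algebra.adjoin_eq_span, restrictSupport_eq_span]
  have hA : (AddSubmonoid.closure A).toSubmonoid.map (monomialOneHom K σ) =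
      Submonoid.closure ((fun u => monomial u (1 : K)) '' A) := by
    rw [AddSubmonoid.toSubmonoid_closure, MonoidHom.map_mclosure]
    rfl
  rw [← hA]
  rfl

theorem mem_toricRing_iff :
    f ∈ toricRing K A ↔ ↑f.support ⊆ (AddSubmonoid.closure A : Set (σ →₀ ℕ)) := by
  rw [← Subalgebra.mem_toSubmodule, toSubmodule_toricRing, mem_restrictSupport_iff]

theorem monomial_mem_toricRing_iff {w : σ →₀ ℕ} :
    monomial w (1 : K) ∈ toricRing K A ↔ w ∈ AddSubmonoid.closure A := by
  simp [← Subalgebra.mem_toSubmodule, toSubmodule_toricRing]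

theorem exists_finite_subset_closure_subset_toricRing {P : Set (MvPolynomial σ K)} (hP : P.Finite)
    (hPA : P ⊆ toricRing K A) :
    ∃ B : Set (σ →₀ ℕ), B.Finite ∧ B ⊆ AddSubmonoid.closure A ∧ P ⊆ toricRing K B :=
  ⟨⋃ p ∈ P, p.support, hP.biUnion fun p _ => p.support.finite_toSet,
    Set.iUnion₂_subset fun _ hp => mem_toricRing_iff.1 (hPA hp),
    fun _ hp => mem_toricRing_iff.2 fun _ hw =>
      AddSubmonoid.subset_closure (Set.mem_biUnion hp hw)⟩

theorem exists_mem_toricRing_support_sub_notMem_closure (A : Set (σ →₀ ℕ)) (f : MvPolynomial σ K) :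
    ∃ g ∈ toricRing K A, ∀ w ∈ (f - g).support, w ∉ AddSubmonoid.closure A := by
  classical
  let g := ∑ w ∈ f.support with w ∈ AddSubmonoid.closure A, monomial w (coeff w f)
  have hg (w) : coeff w g = if w ∈ AddSubmonoid.closure A then coeff w f else 0 := by
    simp +contextual [g, coeff_sum, coeff_monomial, ite_and]
  refine ⟨g, mem_toricRing_iff.2 fun w hw => ?_, fun w hw hwA => ?_⟩
  · simp_all
  · simp [hg, hwA] at hw

theorem exists_nsmul_degree_mem_closure_of_isAlmostIntegral (m : MonomialOrder σ)
    (hA : (AddSubmonoid.closure A).FG) (hf : IsAlmostIntegral (toricRing K A) f) (hf0 : f ≠ 0) :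
    ∃ k ≠ 0, k • m.degree f ∈ AddSubmonoid.closure A := by
  obtain ⟨r, hr, hrf⟩ := hf
  have hr0 : (r : MvPolynomial σ K) ≠ 0 := by exact_mod_cast nonZeroDivisors.ne_zero hr
  refine exists_nsmul_mem_of_forall_add_nsmul_mem hA (a := m.degree r.1) fun k => ?_
  obtain ⟨s, hs : (s : MvPolynomial σ K) = r * f ^ k⟩ := hrf k
  rw [← m.degree_pow, ← m.degree_mul hr0 (pow_ne_zero k hf0), ← hs]
  refine mem_toricRing_iff.1 s.2 (m.degree_mem_support ?_)
  rw [hs]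
  exact mul_ne_zero hr0 (pow_ne_zero k hf0)

theorem exists_nsmul_degree_mem_closure (m : MonomialOrder σ) (hf : IsIntegral (toricRing K A) f)
    (hf0 : f ≠ 0) (hh : h ∈ toricRing K A) (hh0 : h ≠ 0) (hhf : h * f ∈ toricRing K A) :
    ∃ k ≠ 0, k • m.degree f ∈ AddSubmonoid.closure A := by
  -- Dickson's lemma needs a finitely generated monoid: the one generated by the exponents of `h`,
  -- of `h * f` and of the coefficients of an integral equation for `f` suffices.
  obtain ⟨C, hC, hfC⟩ := isIntegral_iff_isIntegral_closure_finite.1 hf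
  have hCA : Subtype.val '' C ⊆ (toricRing K A : Set (MvPolynomial σ K)) :=
    Set.image_subset_iff.2 fun c _ => c.2
  obtain ⟨B, hB, hBA, hPB⟩ := exists_finite_subset_closure_subset_toricRing
    (((hC.image _).insert (h * f)).insert h) (Set.insert_subset hh (Set.insert_subset hhf hCA))
  simp only [Set.insert_subset_iff, SetLike.mem_coe, Set.image_subset_iff] at hPB
  obtain ⟨hhB, hhfB, hCB⟩ := hPB
  have hCB' : Subring.closure C ≤ (toricRing K B).toSubring.comap (toricRing K A).val.toRingHom :=
    Subring.closure_le.2 hCB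
  let φ : Subring.closure C →+* toricRing K B :=
    ((toricRing K A).val.toRingHom.comp (Subring.closure C).subtype).codRestrict
      (toricRing K B) fun c => hCB' c.2
  have hfB : IsIntegral (toricRing K B) f :=
    IsIntegral.map_of_comp_eq φ (RingHom.id (MvPolynomial σ K)) rfl hfC
  have hfB' : IsAlmostIntegral (toricRing K B) f := hfB.isAlmostIntegral_of_exists_smul_mem_range
    ⟨⟨h, hhB⟩, mem_nonZeroDivisors_of_ne_zero (by simpa [Subtype.ext_iff] using hh0),
      ⟨h * f, hhfB⟩, rfl⟩
  obtain ⟨k, hk, hkf⟩ := exists_nsmul_degree_mem_closure_of_isAlmostIntegral m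
    ((AddSubmonoid.fg_iff _).2 ⟨B, rfl, hB⟩) hfB' hf0
  exact ⟨k, hk, AddSubmonoid.closure_le.2 hBA hkf⟩

theorem degree_mem_closure_of_isIntegral (hA : IsNormalMonoid (AddSubmonoid.closure A))
    (m : MonomialOrder σ) (hf : IsIntegral (toricRing K A) f) (hf0 : f ≠ 0)
    (hh : h ∈ toricRing K A) (hh0 : h ≠ 0) (hhf : h * f ∈ toricRing K A) :
    m.degree f ∈ AddSubmonoid.closure A := by
  obtain ⟨k, hk, hkf⟩ := exists_nsmul_degree_mem_closure m hf hf0 hh hh0 hhf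
  refine hA (a := m.degree h) ?_ ?_ hk hkf
  · exact mem_toricRing_iff.1 hh (m.degree_mem_support hh0)
  · rw [← m.degree_mul hh0 hf0]
    exact mem_toricRing_iff.1 hhf (m.degree_mem_support (mul_ne_zero hh0 hf0))

theorem nonempty_monomialOrder (σ : Type u) : Nonempty (MonomialOrder.{u, u} σ) := by
  obtain ⟨_, _⟩ := exists_wellFoundedLT σ
  exact ⟨@MonomialOrder.lex σ (inferInstanceAs (LinearOrder σᵒᵈ))
    (inferInstanceAs (WellFoundedGT σᵒᵈ))⟩

theorem mem_toricRing_of_isIntegral (hA : IsNormalMonoid (AddSubmonoid.closure A))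
    (hf : IsIntegral (toricRing K A) f) (hh : h ∈ toricRing K A) (hh0 : h ≠ 0)
    (hhf : h * f ∈ toricRing K A) : f ∈ toricRing K A := by
  obtain ⟨m⟩ := nonempty_monomialOrder σ
  obtain ⟨g, hg, hfg⟩ := exists_mem_toricRing_support_sub_notMem_closure A f
  suffices f - g = 0 by rwa [sub_eq_zero.1 this]
  by_contra h0
  refine hfg _ (m.degree_mem_support h0) (degree_mem_closure_of_isIntegral hA m ?_ h0 hh hh0 ?_)
  · exact hf.sub (isIntegral_algebraMap (x := (⟨g, hg⟩ : toricRing K A)))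
  · rw [mul_sub]
    exact sub_mem hhf (mul_mem hh hg)

theorem isNormalMonoid_closure_of_isIntegrallyClosed (hA : IsIntegrallyClosed (toricRing K A)) :
    IsNormalMonoid (AddSubmonoid.closure A) := by
  intro a w k ha haw hk hkw
  rw [← monomial_mem_toricRing_iff (K := K)] at ha haw hkw ⊢
  let x : toricRing K A := ⟨_, ha⟩
  let y : toricRing K A := ⟨_, haw⟩
  obtain ⟨c, hc⟩ : x ∣ y := by
    rw [← IsIntegrallyClosed.pow_dvd_pow_iff hk]
    exact ⟨⟨_, hkw⟩, Subtype.ext (by simp [x, y, monomial_pow, monomial_mul])⟩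
  have hxc : monomial a (1 : K) * monomial w 1 = monomial a 1 * (c : MvPolynomial σ K) := by
    simpa [x, y, monomial_mul] using congrArg Subtype.val hc
  rw [mul_left_cancel₀ (by simp) hxc]
  exact c.2

theorem isIntegrallyClosed_toricRing_iff :
    IsIntegrallyClosed (toricRing K A) ↔ IsNormalMonoid (AddSubmonoid.closure A) :=
  ⟨isNormalMonoid_closure_of_isIntegrallyClosed, fun hA =>
    isIntegrallyClosed_of_forall_isIntegral _ fun _ hf _ hh hh0 hhf =>
      mem_toricRing_of_isIntegral hA hf hh hh0 hhf⟩

end ToricRing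

section MapDomain

open scoped Pointwise

variable {σ τ : Type*} (π : σ → τ)

theorem exists_add_eq_of_add_eq_add {p q u v : τ →₀ ℕ} (h : p + q = u + v) :
    ∃ u₁ u₂ v₁ v₂, p = u₁ + v₁ ∧ q = u₂ + v₂ ∧ u = u₁ + u₂ ∧ v = v₁ + v₂ := by
  refine ⟨p ⊓ u, u - p, p - u, v - (p - u), ?_, ?_, ?_, ?_⟩ <;>
  · ext t
    have := DFunLike.congr_fun h t
    simp only [Finsupp.add_apply, Finsupp.inf_apply, Finsupp.tsub_apply] at this ⊢
    omega

theorem exists_add_eq_of_mapDomain_eq_add {w : σ →₀ ℕ} {u v : τ →₀ ℕ} (h : mapDomain π w = u + v) :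
    ∃ a b, a + b = w ∧ mapDomain π a = u ∧ mapDomain π b = v := by
  induction w using Finsupp.induction_linear generalizing u v with
  | zero =>
    obtain ⟨rfl, rfl⟩ : u = 0 ∧ v = 0 := by simpa [eq_comm] using h
    exact ⟨0, 0, by simp⟩
  | add w₁ w₂ ih₁ ih₂ =>
    rw [Finsupp.mapDomain_add] at h
    obtain ⟨u₁, u₂, v₁, v₂, h₁, h₂, rfl, rfl⟩ := exists_add_eq_of_add_eq_add h
    obtain ⟨a₁, b₁, rfl, rfl, rfl⟩ := ih₁ h₁
    obtain ⟨a₂, b₂, rfl, rfl, rfl⟩ := ih₂ h₂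
    exact ⟨a₁ + a₂, b₁ + b₂, add_add_add_comm .., Finsupp.mapDomain_add, Finsupp.mapDomain_add⟩
  | single s n =>
    rw [Finsupp.mapDomain_single] at h
    classical
    have hsingle (t) : (if π s = t then n else 0) = u t + v t := by
      rw [← Finsupp.single_apply, h, Finsupp.add_apply]
    refine ⟨Finsupp.single s (u (π s)), Finsupp.single s (v (π s)), ?_, ?_, ?_⟩
    · rw [← Finsupp.single_add, ← hsingle, if_pos rfl]
    all_goals
      ext t
      have := hsingle t
      rw [Finsupp.mapDomain_single, Finsupp.single_apply]
      split_ifs at * with hst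
      · rw [hst]
      · omega

theorem preimage_mapDomain_singleton_add (u v : τ →₀ ℕ) :
    mapDomain π ⁻¹' {u + v} = mapDomain π ⁻¹' {u} + (mapDomain π ⁻¹' {v} : Set (σ →₀ ℕ)) := by
  ext w
  simp only [Set.mem_add, Set.mem_preimage, Set.mem_singleton_iff]
  constructor
  · intro hw
    obtain ⟨a, b, hab, ha, hb⟩ := exists_add_eq_of_mapDomain_eq_add π hw
    exact ⟨a, ha, b, hb, hab⟩
  · rintro ⟨a, rfl, b, rfl, rfl⟩
    exact Finsupp.mapDomain_add

theorem preimage_mapDomain_singleton_zero :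
    mapDomain π ⁻¹' {(0 : τ →₀ ℕ)} = {(0 : σ →₀ ℕ)} := by
  ext w
  exact Finsupp.mapDomain_apply_eq_zero_iff_of_subsingletonAddUnits π w

theorem preimage_mapDomain_singleton_single_one (t : τ) :
    mapDomain π ⁻¹' {Finsupp.single t 1} = (fun s => Finsupp.single s 1) '' (π ⁻¹' {t}) := by
  ext w
  constructor
  · intro hw
    have hw0 : w ≠ 0 := by
      rintro rfl
      simp [eq_comm] at hw
    obtain ⟨s, hs⟩ := Finsupp.ne_iff.1 hw0
    obtain ⟨v, rfl⟩ := exists_add_of_le (Finsupp.single_le_iff.2 (Nat.one_le_iff_ne_zero.2 hs))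
    rw [Set.mem_preimage, Set.mem_singleton_iff, Finsupp.mapDomain_add,
      Finsupp.mapDomain_single] at hw
    obtain rfl : π s = t := by
      by_contra hst
      simpa [Finsupp.single_eq_of_ne hst] using DFunLike.congr_fun hw (π s)
    rw [add_eq_left, Finsupp.mapDomain_apply_eq_zero_iff_of_subsingletonAddUnits] at hw
    exact ⟨s, rfl, by rw [hw, add_zero]⟩
  · rintro ⟨s, rfl, rfl⟩
    exact Finsupp.mapDomain_single

theorem isAntichain_preimage_mapDomain_singleton (u : τ →₀ ℕ) :
    IsAntichain (· ≤ ·) (mapDomain π ⁻¹' {u} : Set (σ →₀ ℕ)) := by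
  rintro v rfl w hw hne hvw
  obtain ⟨c, rfl⟩ := exists_add_of_le hvw
  have hc : mapDomain π c = 0 := by simpa [Finsupp.mapDomain_add] using hw
  rw [Finsupp.mapDomain_apply_eq_zero_iff_of_subsingletonAddUnits] at hc
  simp [hc] at hne

theorem closure_preimage_mapDomain (A : Set (τ →₀ ℕ)) :
    AddSubmonoid.closure (mapDomain π ⁻¹' A) =
      (AddSubmonoid.closure A).comap (Finsupp.mapDomain.addMonoidHom π) := by
  refine le_antisymm (AddSubmonoid.closure_le.2 fun w hw => AddSubmonoid.subset_closure hw) ?_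
  intro w (hw : mapDomain π w ∈ AddSubmonoid.closure A)
  generalize hu : mapDomain π w = u at hw
  induction hw using AddSubmonoid.closure_induction generalizing w with
  | mem u hu' => exact AddSubmonoid.subset_closure (by simpa [hu])
  | zero =>
    rw [(Finsupp.mapDomain_apply_eq_zero_iff_of_subsingletonAddUnits π w).1 hu]
    exact zero_mem _
  | add u v _ _ ihu ihv =>
    obtain ⟨a, b, rfl, ha, hb⟩ := exists_add_eq_of_mapDomain_eq_add π hu
    exact add_mem (ihu ha) (ihv hb)

end MapDomain

section FiberIdeal

variable {σ τ : Type*} (R : Type*) [CommSemiring R] (π : σ → τ)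

/-- The monomial ideal spanned by the monomials of multidegree `u` when the variable `x_s` has the
multidegree of `x_{π s}`. For `π (i, j) = i` this is the product `P_1 ^ u(1) ⋯ P_n ^ u(n)`. -/
noncomputable def fiberIdeal (u : τ →₀ ℕ) : Ideal (MvPolynomial σ R) :=
  Ideal.span ((fun w => monomial w (1 : R)) '' (mapDomain π ⁻¹' {u}))

theorem fiberIdeal_zero : fiberIdeal R π (0 : τ →₀ ℕ) = 1 := by
  rw [fiberIdeal, preimage_mapDomain_singleton_zero, Set.image_singleton, monomial_zero', C_1,
    Ideal.span_singleton_one, Ideal.one_eq_top]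

theorem fiberIdeal_add (u v : τ →₀ ℕ) :
    fiberIdeal R π (u + v) = fiberIdeal R π u * fiberIdeal R π v := by
  rw [fiberIdeal, fiberIdeal, fiberIdeal, Ideal.span_mul_span', preimage_mapDomain_singleton_add]
  congr 1
  simp [← Set.image2_add, ← Set.image2_mul, Set.image_image2, Set.image2_image_left,
    Set.image2_image_right, monomial_mul]

theorem fiberIdeal_single_one (t : τ) :
    fiberIdeal R π (Finsupp.single t 1) = Ideal.span (X '' (π ⁻¹' {t})) := by
  rw [fiberIdeal, preimage_mapDomain_singleton_single_one, Set.image_image]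
  rfl

theorem fiberIdeal_eq_prod [Fintype τ] (u : τ →₀ ℕ) :
    fiberIdeal R π u = ∏ t, fiberIdeal R π (Finsupp.single t 1) ^ u t := by
  classical
  induction u using Finsupp.induction_linear with
  | zero => simp [fiberIdeal_zero, -Ideal.one_eq_top]
  | add u v hu hv =>
    simp only [fiberIdeal_add, hu, hv, Finsupp.add_apply, pow_add, Finset.prod_mul_distrib]
  | single t k =>
    rw [Finset.prod_eq_single t (fun t' _ ht => by simp [ht]) (by simp), Finsupp.single_eq_same]
    induction k with
    | zero => simp [fiberIdeal_zero]
    | succ k ih => rw [Finsupp.single_add, fiberIdeal_add, ih, pow_succ]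

theorem minimalGenerators_span_of_isAntichain (K : Type*) [Field K] {s : Set (σ →₀ ℕ)}
    (hs : IsAntichain (· ≤ ·) s) :
    minimalGenerators (Ideal.span ((fun w => monomial w (1 : K)) '' s)) = s := by
  classical
  ext w
  rw [← hs.minimal_mem_upperClosure_iff_mem]
  simp [minimalGenerators, mem_ideal_span_monomial_image, support_monomial]

end FiberIdeal

section Expansion

variable {n : ℕ} (K : Type*) [Field K] (α : Fin n → ℕ)

theorem blockIdeal_eq_fiberIdeal (j : Fin n) :
    blockIdeal K α j = fiberIdeal K Sigma.fst (Finsupp.single j 1) := by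
  rw [fiberIdeal_single_one, blockIdeal]
  congr 1
  ext
  simp

theorem expandIdeal_span_monomial (u : Fin n →₀ ℕ) :
    expandIdeal α (Ideal.span {monomial u (1 : K)}) = fiberIdeal K Sigma.fst u := by
  have hu : minimalGenerators (Ideal.span {monomial u (1 : K)}) = {u} := by
    simpa using minimalGenerators_span_of_isAntichain K (IsAntichain.singleton (a := u))
  simp [expandIdeal, hu, blockIdeal_eq_fiberIdeal, ← fiberIdeal_eq_prod]

theorem expandSet_eq_preimage (A : Set (Fin n →₀ ℕ)) :
    expandSet K α A = mapDomain Sigma.fst ⁻¹' A := by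
  simp only [expandSet, expandIdeal_span_monomial, fiberIdeal,
    minimalGenerators_span_of_isAntichain K (isAntichain_preimage_mapDomain_singleton _ _)]
  exact Set.biUnion_preimage_singleton _ _

theorem surjective_fst_expandedVars {α : Fin n → ℕ} (hα : ∀ i, 1 ≤ α i) :
    Function.Surjective (Sigma.fst : ExpandedVars α → Fin n) :=
  fun i => ⟨⟨i, 0, hα i⟩, rfl⟩

end Expansion

end Expansion

theorem mainTheorem6_general {K : Type*} [Field K] {n : ℕ} (α : Fin n → ℕ) (hα : ∀ i, 1 ≤ α i)
    (A : Set (Fin n →₀ ℕ)) :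
    IsIntegrallyClosed (Expansion.toricRing K A) ↔
      IsIntegrallyClosed (Expansion.toricRing K (Expansion.expandSet K α A)) := by
  have hsurj := Finsupp.mapDomain_surjective (M := ℕ) (Expansion.surjective_fst_expandedVars hα)
  rw [Expansion.expandSet_eq_preimage, Expansion.isIntegrallyClosed_toricRing_iff,
    Expansion.isIntegrallyClosed_toricRing_iff, Expansion.closure_preimage_mapDomain,
    Expansion.isNormalMonoid_comap_iff hsurj]

theorem mainTheorem6 {K : Type*} [Field K] {n : ℕ} (α : Fin n → ℕ) (hα : ∀ i, 1 ≤ α i)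
    (A : Set (Fin n →₀ ℕ)) (hA : A.Finite) :
    IsIntegrallyClosed (Expansion.toricRing K A) ↔
      IsIntegrallyClosed (Expansion.toricRing K (Expansion.expandSet K α A)) :=
  mainTheorem6_general α hα A
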